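/- Let $p\neq 5$ be a prime. There is a constant $c_p>0$, depending only on $p$, such that for every integer $n\ge 0$ and every set $A\subseteq \mathbb{F}_p^n$ the following holds. If there are no $x_1,\dots,x_5,y\in A$ satisfying $$x_1+x_2+x_3+x_4+x_5=5y$$ with $x_i\neq y$ for some $i\in\{1,\dots,5\}$, then $$|A|\le p^n\exp\bigl(-c_p(\log_2 p^n)^{1/5}\bigr).$$ -/

import Mathlib

open Finset

/-! Putting x₃ = x₄ = x₅ = y turns the equation into x₁ + x₂ = 2y, so A has no nontrivial three-term
progression. The slice rank method then saves a factor exponential in n, far more than the exponent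
1/5 asks. On A the diagonal tensor is the product over coordinates of the indicator of x + y = 2z, a
polynomial of degree at most (p - 1)n. In each monomial one of x, y, z carries at most a third of
that degree, so |A| is at most three times the number of low-degree monomials, an exponentially
small share of p^n. -/

/-! ### Slice rank of the diagonal tensor -/

/-- A subspace of `α → F` contains a vector whose support is at least its dimension. -/
theorem exists_mem_finrank_le_card_support {α F : Type*} [Field F] [Fintype α] [DecidableEq α]
    [DecidableEq F] (W : Submodule F (α → F)) :
    ∃ h ∈ W, Module.finrank F W ≤ Fintype.card {a // h a ≠ 0} := by
  classical
  obtain ⟨h, hW, hmax⟩ := Set.exists_max_image ((fun h : α → F => univ.filter fun a => h a ≠ 0) '' W)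
    Finset.card (Set.toFinite _) ⟨_, 0, W.zero_mem, rfl⟩
  obtain ⟨v, hv, rfl⟩ := hW
  refine ⟨v, hv, ?_⟩
  by_contra! hlt
  -- If the maximal support is smaller than dim W, some nonzero w in W vanishes on it, and v + w has
  -- larger support.
  let r : W →ₗ[F] ({a // v a ≠ 0} → F) :=
    (LinearMap.funLeft F F (Subtype.val : {a // v a ≠ 0} → α)).comp W.subtype
  have hr : LinearMap.ker r ≠ ⊥ := LinearMap.ker_ne_bot_of_finrank_lt (by simpa using hlt)
  obtain ⟨w, hw, hw0⟩ := Submodule.exists_mem_ne_zero_of_ne_bot hr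
  have hvan : ∀ a, v a ≠ 0 → (w : α → F) a = 0 := fun a ha => by
    simpa [r] using congrFun (LinearMap.mem_ker.1 hw) ⟨a, ha⟩
  obtain ⟨b, hb⟩ : ∃ b, (w : α → F) b ≠ 0 := by
    by_contra! hcon
    exact hw0 (Subtype.ext (funext hcon))
  have hvb : v b = 0 := by
    by_contra hvb
    exact hb (hvan b hvb)
  refine absurd (hmax _ ⟨v + w, W.add_mem hv w.2, rfl⟩) (not_le.2 (Finset.card_lt_card ?_))
  refine Finset.ssubset_iff_subset_ne.2 ⟨fun a ha => ?_, fun heq => ?_⟩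
  · have ha' : v a ≠ 0 := by simpa using ha
    simpa [hvan a ha'] using ha'
  · have : b ∈ univ.filter fun a => v a ≠ 0 := by
      have hb' : b ∈ univ.filter fun a => (v + w : α → F) a ≠ 0 := by simpa [hvb] using hb
      exact (Finset.ext_iff.1 heq b).2 hb'
    simp [hvb] at this

/-- The slice rank of the diagonal tensor on `α × α × α` is at least the cardinality of `α`. -/
theorem card_le_of_diagonal_eq_sum_slices {α F I J K : Type*} [Field F] [Fintype α]
    [DecidableEq α] [Fintype I] [Fintype J] [Fintype K]
    (f₁ : I → α → F) (g₁ : I → α → α → F) (f₂ : J → α → F) (g₂ : J → α → α → F)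
    (f₃ : K → α → F) (g₃ : K → α → α → F)
    (h : ∀ x y z, (if x = y ∧ y = z then (1 : F) else 0) =
      ∑ i, f₁ i x * g₁ i y z + ∑ j, f₂ j y * g₂ j x z + ∑ k, f₃ k z * g₃ k x y) :
    Fintype.card α ≤ Fintype.card I + Fintype.card J + Fintype.card K := by
  classical
  -- Contracting z against a v orthogonal to every `f₃ k` kills the third kind of slice and leaves
  -- the matrix diag(v), of rank at most |I| + |J|.
  let φ : (α → F) →ₗ[F] (K → F) := (Matrix.of f₃).mulVecLin
  obtain ⟨v, hv, hcard⟩ := exists_mem_finrank_le_card_support (LinearMap.ker φ)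
  have hker : Fintype.card α ≤ Fintype.card K + Module.finrank F (LinearMap.ker φ) := by
    have h₁ := LinearMap.finrank_range_add_finrank_ker φ
    have h₂ := Submodule.finrank_le (LinearMap.range φ)
    simp only [Module.finrank_fintype_fun_eq_card] at h₁ h₂
    omega
  have hv' : ∀ k, ∑ z, v z * f₃ k z = 0 := fun k => by
    have := congrFun (LinearMap.mem_ker.1 hv) k
    simpa [φ, Matrix.mulVec, dotProduct, mul_comm] using this
  have hdiag : Matrix.diagonal v =
      (Matrix.of fun (x : α) (s : I ⊕ J) =>
        Sum.elim (fun i => f₁ i x) (fun j => ∑ z, v z * g₂ j x z) s) *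
      (Matrix.of fun (s : I ⊕ J) (y : α) =>
        Sum.elim (fun i => ∑ z, v z * g₁ i y z) (fun j => f₂ j y) s) := by
    ext x y
    have e₀ : Matrix.diagonal v x y = ∑ z, v z * (if x = y ∧ y = z then (1 : F) else 0) := by
      by_cases hxy : x = y
      · subst hxy
        simp
      · simp [hxy]
    have e₁ : ∑ z, v z * ∑ i, f₁ i x * g₁ i y z = ∑ i, f₁ i x * ∑ z, v z * g₁ i y z := by
      simp_rw [mul_sum]
      rw [sum_comm]
      exact sum_congr rfl fun _ _ => sum_congr rfl fun _ _ => by ring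
    have e₂ : ∑ z, v z * ∑ j, f₂ j y * g₂ j x z = ∑ j, (∑ z, v z * g₂ j x z) * f₂ j y := by
      simp_rw [mul_sum, sum_mul]
      rw [sum_comm]
      exact sum_congr rfl fun _ _ => sum_congr rfl fun _ _ => by ring
    have e₃ : ∑ z, v z * ∑ k, f₃ k z * g₃ k x y = 0 := by
      have : ∑ z, v z * ∑ k, f₃ k z * g₃ k x y = ∑ k, (∑ z, v z * f₃ k z) * g₃ k x y := by
        simp_rw [mul_sum, sum_mul]
        rw [sum_comm]
        exact sum_congr rfl fun _ _ => sum_congr rfl fun _ _ => by ring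
      simp [this, hv']
    rw [e₀]
    simp_rw [h, mul_add, sum_add_distrib]
    rw [e₁, e₂, e₃, add_zero]
    simp [Matrix.mul_apply]
  have hrank : Fintype.card {a // v a ≠ 0} ≤ Fintype.card I + Fintype.card J := by
    rw [← Matrix.rank_diagonal v, hdiag, ← Fintype.card_sum]
    exact (Matrix.rank_mul_le_left _ _).trans (Matrix.rank_le_card_width _)
  omega

/-! ### The polynomial method -/

/-- The indicator of `v 0 + v 1 = 2 * v 2` over `ZMod p` is a polynomial of degree at most
`p - 1`. -/
theorem exists_mvPolynomial_eval_eq_indicator (p : ℕ) [Fact p.Prime] :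
    ∃ P : MvPolynomial (Fin 3) (ZMod p), P.totalDegree ≤ p - 1 ∧
      ∀ v : Fin 3 → ZMod p, MvPolynomial.eval v P = if v 0 + v 1 = 2 * v 2 then 1 else 0 := by
  have hp : p - 1 ≠ 0 := by have := (Fact.out : p.Prime).two_le; omega
  -- Fermat's little theorem.
  refine ⟨1 - (MvPolynomial.X 0 + MvPolynomial.X 1 - MvPolynomial.C 2 * MvPolynomial.X 2) ^ (p - 1),
    ?_, fun v => ?_⟩
  · refine (MvPolynomial.totalDegree_sub _ _).trans (max_le (by simp) ?_)
    refine (MvPolynomial.totalDegree_pow _ _).trans ?_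
    refine (Nat.mul_le_mul_left _ ?_).trans (mul_one _).le
    refine (MvPolynomial.totalDegree_sub _ _).trans (max_le ?_ ?_)
    · refine (MvPolynomial.totalDegree_add _ _).trans (by simp)
    · refine (MvPolynomial.totalDegree_mul _ _).trans (by simp)
  · by_cases h : v 0 + v 1 = 2 * v 2
    · simp [h, hp]
    · have := ZMod.pow_card_sub_one_eq_one (sub_ne_zero.2 h)
      simp [h, this]

/-- Exponent vectors with entries below `p` and degree at most a third of the maximum. -/
abbrev LowDegreeExponent (p n : ℕ) : Type :=
  {u : Fin n → Fin p // 3 * ∑ i, (u i : ℕ) ≤ (p - 1) * n}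

/-- A sum of products over a class of indices of low degree in the first factor is a sum of
slices. -/
theorem exists_slices_of_low_degree {p n : ℕ} {R ι X Y : Type*} [CommSemiring R] (C : Finset ι)
    (e : ι → Fin n → ℕ) (he : ∀ t ∈ C, ∀ i, e t i < p)
    (hC : ∀ t ∈ C, 3 * ∑ i, e t i ≤ (p - 1) * n) (w : X → Fin n → R) (G : ι → Y → R) :
    ∃ g : LowDegreeExponent p n → Y → R, ∀ x y,
      ∑ t ∈ C, (∏ i, w x i ^ e t i) * G t y = ∑ u, (∏ i, w x i ^ (u.1 i : ℕ)) * g u y := by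
  classical
  refine ⟨fun u y => ∑ t ∈ C with e t = fun i => (u.1 i : ℕ), G t y, fun x y => ?_⟩
  have key : ∀ t ∈ C, (∏ i, w x i ^ e t i) * G t y =
      ∑ u : LowDegreeExponent p n, if e t = fun i => (u.1 i : ℕ) then
        (∏ i, w x i ^ (u.1 i : ℕ)) * G t y else 0 := fun t ht => by
    rw [Finset.sum_eq_single (⟨fun i => ⟨e t i, he t ht i⟩, hC t ht⟩ : LowDegreeExponent p n)]
    · simp
    · intro u _ hu
      refine if_neg fun heq => hu (Subtype.ext (funext fun i => Fin.ext ?_))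
      exact (congrFun heq i).symm
    · simp
  rw [sum_congr rfl key, sum_comm]
  refine sum_congr rfl fun u _ => ?_
  rw [mul_sum, sum_filter]

/-- The slice rank bound for sets without three-term progressions in `F_p^n`. -/
theorem card_le_three_mul_card_lowDegreeExponent (p : ℕ) [Fact p.Prime] (n : ℕ)
    (A : Finset (Fin n → ZMod p))
    (hA : ∀ x ∈ A, ∀ y ∈ A, ∀ z ∈ A, x + y = (2 : ZMod p) • z → x = z ∧ y = z) :
    A.card ≤ 3 * Fintype.card (LowDegreeExponent p n) := by
  classical
  have hp := (Fact.out : p.Prime).two_le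
  obtain ⟨P, hdeg, hP⟩ := exists_mvPolynomial_eval_eq_indicator p
  -- An index picks one monomial of `P` in each coordinate.
  let ι := Fin n → P.support
  have hs : ∀ (t : ι) (i : Fin n), (t i).1 0 + (t i).1 1 + (t i).1 2 ≤ p - 1 := fun t i => by
    have := (MvPolynomial.le_totalDegree (t i).2).trans hdeg
    rwa [Finsupp.sum_fintype _ _ (by simp), Fin.sum_univ_three] at this
  have hlt : ∀ (l : Fin 3) (t : ι) (i : Fin n), (t i).1 l < p := fun l t i => by
    have := hs t i
    fin_cases l <;> simp <;> omega
  let D : Fin 3 → ι → Prop := fun l t => 3 * ∑ i, (t i).1 l ≤ (p - 1) * n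
  have hD : ∀ t, D 0 t ∨ D 1 t ∨ D 2 t := fun t => by
    have : ∑ i, ((t i).1 0 + (t i).1 1 + (t i).1 2) ≤ n * (p - 1) := by
      simpa using Finset.sum_le_card_nsmul univ _ (p - 1) (fun i _ => hs t i)
    rw [sum_add_distrib, sum_add_distrib, mul_comm] at this
    simp only [D]
    omega
  let m : A → Fin n → ZMod p := fun x => x.1
  let c : ι → ZMod p := fun t => ∏ i, P.coeff (t i).1
  let mon : Fin 3 → ι → A → ZMod p := fun l t x => ∏ i, m x i ^ (t i).1 l
  have hexp : ∀ x y z : A, (if x = y ∧ y = z then (1 : ZMod p) else 0) =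
      ∑ t : ι, c t * (mon 0 t x * mon 1 t y * mon 2 t z) := fun x y z => by
    have h₁ : (if x = y ∧ y = z then (1 : ZMod p) else 0) =
        ∏ i, MvPolynomial.eval ![m x i, m y i, m z i] P := by
      simp_rw [hP]
      rw [Finset.prod_ite_zero]
      simp only [prod_const_one]
      refine if_congr ⟨?_, fun h => ?_⟩ rfl rfl
      · rintro ⟨rfl, rfl⟩ i _
        simp [two_mul]
      · have := hA x.1 x.2 y.1 y.2 z.1 z.2 (funext fun i => by simpa using h i (mem_univ i))
        exact ⟨Subtype.ext (this.1.trans this.2.symm), Subtype.ext this.2⟩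
    have h₂ : ∀ i, MvPolynomial.eval ![m x i, m y i, m z i] P =
        ∑ s : P.support, P.coeff s.1 * (m x i ^ s.1 0 * m y i ^ s.1 1 * m z i ^ s.1 2) := fun i => by
      rw [MvPolynomial.eval_eq', ← Finset.sum_coe_sort]
      simp [Fin.prod_univ_three]
    rw [h₁]
    simp_rw [h₂]
    rw [Finset.prod_univ_sum, Fintype.piFinset_univ]
    refine sum_congr rfl fun t _ => ?_
    simp only [c, mon, prod_mul_distrib]
  -- Each term goes to the first of its variables that has low degree, so the three classes
  -- partition the expansion.
  obtain ⟨g₁, hg₁⟩ := exists_slices_of_low_degree (p := p) (univ.filter fun t => D 0 t)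
    (fun t i => (t i).1 0) (fun t _ => hlt 0 t) (fun t ht => (mem_filter.1 ht).2) m
    (fun t (q : A × A) => c t * (mon 1 t q.1 * mon 2 t q.2))
  obtain ⟨g₂, hg₂⟩ := exists_slices_of_low_degree (p := p) (univ.filter fun t => ¬ D 0 t ∧ D 1 t)
    (fun t i => (t i).1 1) (fun t _ => hlt 1 t) (fun t ht => (mem_filter.1 ht).2.2) m
    (fun t (q : A × A) => c t * (mon 0 t q.1 * mon 2 t q.2))
  obtain ⟨g₃, hg₃⟩ := exists_slices_of_low_degree (p := p) (univ.filter fun t => ¬ D 0 t ∧ ¬ D 1 t)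
    (fun t i => (t i).1 2) (fun t _ => hlt 2 t)
    (fun t ht => (((hD t).resolve_left (mem_filter.1 ht).2.1).resolve_left (mem_filter.1 ht).2.2)) m
    (fun t (q : A × A) => c t * (mon 0 t q.1 * mon 1 t q.2))
  have := card_le_of_diagonal_eq_sum_slices
    (fun (u : LowDegreeExponent p n) (x : A) => ∏ i, m x i ^ (u.1 i : ℕ)) (fun u y z => g₁ u (y, z))
    (fun (u : LowDegreeExponent p n) (x : A) => ∏ i, m x i ^ (u.1 i : ℕ)) (fun u x z => g₂ u (x, z))
    (fun (u : LowDegreeExponent p n) (x : A) => ∏ i, m x i ^ (u.1 i : ℕ)) (fun u x y => g₃ u (x, y))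
    (fun x y z => by
      rw [hexp, ← hg₁, ← hg₂, ← hg₃, sum_filter, sum_filter, sum_filter, ← sum_add_distrib,
        ← sum_add_distrib]
      refine sum_congr rfl fun t _ => ?_
      by_cases h0 : D 0 t
      · simp only [h0, if_true, not_true, false_and, if_false, mon]
        ring
      · by_cases h1 : D 1 t
        · simp only [h0, h1, if_true, not_true, not_false_iff, and_false, and_true, if_false, mon]
          ring
        · simp only [h0, h1, if_true, not_false_iff, and_false, and_true, if_false, mon]
          ring)
  rw [Fintype.card_coe] at this
  omega

/-! ### Counting low-degree monomials -/

/-- The Chernoff bound for the number of exponent vectors of low degree. -/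
theorem exists_card_lowDegreeExponent_le (p : ℕ) (hp : 2 ≤ p) :
    ∃ ρ : ℝ, 0 < ρ ∧ ρ < 1 ∧ ∀ n : ℕ,
      (Fintype.card (LowDegreeExponent p n) : ℝ) ≤ ((p : ℝ) * ρ) ^ n := by
  classical
  have hp' : (2 : ℝ) ≤ p := by exact_mod_cast hp
  obtain ⟨s, hs0, hs1, hs⟩ : ∃ s : ℝ, 0 < s ∧ s < 1 ∧
      ∑ j : Fin p, s ^ (3 * (j : ℕ)) < p * s ^ (p - 1) := by
    -- Here h(1) = 0 and h'(1) = 3p(p - 1)/2 - p(p - 1) > 0, so h < 0 just left of 1.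
    let h : ℝ → ℝ := fun s => ∑ j ∈ range p, s ^ (3 * j) - p * s ^ (p - 1)
    have hd : HasDerivAt h (∑ j ∈ range p, (3 * j : ℕ) * (1 : ℝ) ^ (3 * j - 1) -
        p * ((p - 1 : ℕ) * (1 : ℝ) ^ (p - 1 - 1))) 1 :=
      (HasDerivAt.fun_sum fun j _ => hasDerivAt_pow (3 * j) (1 : ℝ)).sub
        ((hasDerivAt_pow (p - 1) (1 : ℝ)).const_mul (p : ℝ))
    have hsum : ∑ j ∈ range p, (j : ℝ) = p * (p - 1) / 2 := by
      have := Finset.sum_range_id_mul_two p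
      have h2 : ((∑ j ∈ range p, j : ℕ) : ℝ) * 2 = p * ((p - 1 : ℕ) : ℝ) := by exact_mod_cast this
      rw [Nat.cast_sub (by omega)] at h2
      push_cast at h2
      linarith
    have hpos : 0 < ∑ j ∈ range p, (3 * j : ℕ) * (1 : ℝ) ^ (3 * j - 1) -
        p * ((p - 1 : ℕ) * (1 : ℝ) ^ (p - 1 - 1)) := by
      simp only [one_pow, mul_one, Nat.cast_mul, ← mul_sum, hsum]
      rw [Nat.cast_sub (by omega)]
      push_cast
      nlinarith
    have h1 : h 1 = 0 := by simp [h]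
    have hev := (hasDerivAt_iff_tendsto_slope_left_right.1 hd).1.eventually (lt_mem_nhds hpos)
    have hI : ∀ᶠ s : ℝ in nhdsWithin 1 (Set.Iio 1), s ∈ Set.Ioo (0 : ℝ) 1 :=
      Ioo_mem_nhdsLT one_pos
    obtain ⟨s, hsl, hs0, hs1⟩ := (hev.and hI).exists
    refine ⟨s, hs0, hs1, ?_⟩
    rw [slope_def_field, h1, sub_zero] at hsl
    have : h s < 0 := by
      by_contra! hcon
      exact absurd hsl (not_lt.2 (div_nonpos_of_nonneg_of_nonpos hcon (by linarith)))
    rw [Fin.sum_univ_eq_sum_range (fun j => s ^ (3 * j))]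
    simpa [h] using this
  have hsp : 0 < s ^ (p - 1) := by positivity
  have hp0 : (0 : ℝ) < p := by linarith
  have hG : 0 < ∑ j : Fin p, s ^ (3 * (j : ℕ)) :=
    Finset.sum_pos (fun j _ => by positivity) ⟨⟨0, by omega⟩, mem_univ _⟩
  refine ⟨(∑ j : Fin p, s ^ (3 * (j : ℕ))) / (p * s ^ (p - 1)), by positivity,
    (div_lt_one (by positivity)).2 hs, fun n => ?_⟩
  have hmul : (p : ℝ) * ((∑ j : Fin p, s ^ (3 * (j : ℕ))) / (p * s ^ (p - 1))) =
      (∑ j : Fin p, s ^ (3 * (j : ℕ))) / s ^ (p - 1) := by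
    field_simp
  rw [hmul, div_pow, le_div_iff₀ (by positivity), Fintype.sum_pow, ← pow_mul, ← nsmul_eq_mul,
    ← Finset.card_univ, ← Finset.sum_const]
  calc ∑ _u : LowDegreeExponent p n, s ^ ((p - 1) * n)
      ≤ ∑ u : LowDegreeExponent p n, ∏ i, s ^ (3 * (u.1 i : ℕ)) := by
        refine sum_le_sum fun u _ => ?_
        rw [Finset.prod_pow_eq_pow_sum, ← mul_sum]
        exact pow_le_pow_of_le_one hs0.le hs1.le u.2
    _ = ∑ u : Fin n → Fin p with 3 * ∑ i, (u i : ℕ) ≤ (p - 1) * n,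
          ∏ i, s ^ (3 * (u i : ℕ)) :=
        (Finset.sum_subtype _ (by simp) fun u : Fin n → Fin p => ∏ i, s ^ (3 * (u i : ℕ))).symm
    _ ≤ ∑ u : Fin n → Fin p, ∏ i, s ^ (3 * (u i : ℕ)) :=
        Finset.sum_le_sum_of_subset_of_nonneg (filter_subset _ _) fun u _ _ => by positivity

/-- The Ellenberg–Gijswijt bound. -/
theorem exists_card_le_of_threeAPFree (p : ℕ) [Fact p.Prime] :
    ∃ ρ : ℝ, 0 < ρ ∧ ρ < 1 ∧ ∀ (n : ℕ) (A : Finset (Fin n → ZMod p)),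
      (∀ x ∈ A, ∀ y ∈ A, ∀ z ∈ A, x + y = (2 : ZMod p) • z → x = z ∧ y = z) →
      (A.card : ℝ) ≤ 3 * ((p : ℝ) * ρ) ^ n := by
  obtain ⟨ρ, h0, h1, h⟩ := exists_card_lowDegreeExponent_le p (Fact.out : p.Prime).two_le
  refine ⟨ρ, h0, h1, fun n A hA => ?_⟩
  calc (A.card : ℝ) ≤ 3 * (Fintype.card (LowDegreeExponent p n) : ℝ) := by
        exact_mod_cast card_le_three_mul_card_lowDegreeExponent p n A hA
    _ ≤ _ := by gcongr; exact h n

/-- A three-term-progression-free set in positive dimension is not the whole space. -/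
theorem card_lt_of_threeAPFree (p : ℕ) [Fact p.Prime] {n : ℕ} (hn : n ≠ 0)
    (A : Finset (Fin n → ZMod p))
    (hA : ∀ x ∈ A, ∀ y ∈ A, ∀ z ∈ A, x + y = (2 : ZMod p) • z → x = z ∧ y = z) :
    A.card + 1 ≤ p ^ n := by
  have hne : A ≠ univ := by
    rintro rfl
    have := (hA 1 (mem_univ _) (-1) (mem_univ _) 0 (mem_univ _) (by simp)).1
    have := congrFun this ⟨0, Nat.pos_of_ne_zero hn⟩
    simp at this
  have := (Finset.card_lt_iff_ne_univ A).2 hne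
  simpa [ZMod.card] using this

/-- An exponential saving with a multiplicative loss can be made lossless, given a trivial
saving in every dimension. -/
theorem exists_exp_decay_of_le {q ρ : ℝ} (hq : 1 < q) (h0 : 0 < ρ) (h1 : ρ < 1) :
    ∃ c : ℝ, 0 < c ∧ ∀ (n : ℕ) (a : ℝ), a ≤ 3 * (q * ρ) ^ n → a + 1 ≤ q ^ n →
      a ≤ q ^ n * Real.exp (-c * n) := by
  have hsq0 : 0 < √ρ := Real.sqrt_pos.2 h0
  have hsq1 : √ρ < 1 := by rw [Real.sqrt_lt' one_pos]; simpa using h1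
  obtain ⟨N, hN⟩ := exists_pow_lt_of_lt_one (show (0 : ℝ) < 1 / 3 by norm_num) hsq1
  have hq0 : 0 < q := by linarith
  -- For n ≥ N one factor √ρ^n absorbs the 3; for n ≤ N the saving 1 - q^(-n) ≤ exp(-q^(-N))
  -- suffices.
  refine ⟨min (-Real.log √ρ) ((q ^ N)⁻¹ / (N + 1)),
    lt_min (neg_pos.2 (Real.log_neg hsq0 hsq1)) (by positivity), fun n a ha ha' => ?_⟩
  have hqn : 0 < q ^ n := by positivity
  rcases le_total N n with hNn | hNn
  · have hpow : 3 * √ρ ^ n ≤ 1 := by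
      have := pow_le_pow_of_le_one hsq0.le hsq1.le hNn
      linarith
    have hexp : √ρ ^ n ≤ Real.exp (-min (-Real.log √ρ) ((q ^ N)⁻¹ / (N + 1)) * n) := by
      rw [← Real.exp_log (pow_pos hsq0 n), Real.log_pow, Real.exp_le_exp, mul_comm]
      refine mul_le_mul_of_nonneg_right ?_ (Nat.cast_nonneg n)
      linarith [min_le_left (-Real.log √ρ) ((q ^ N)⁻¹ / (N + 1))]
    have hρ : ρ ^ n = √ρ ^ n * √ρ ^ n := by rw [← mul_pow, Real.mul_self_sqrt h0.le]
    calc a ≤ 3 * (q * ρ) ^ n := ha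
      _ = q ^ n * ((3 * √ρ ^ n) * √ρ ^ n) := by rw [mul_pow, hρ]; ring
      _ ≤ q ^ n * (1 * √ρ ^ n) := by gcongr
      _ ≤ _ := by rw [one_mul]; gcongr
  · have hle : a ≤ q ^ n * (1 - (q ^ n)⁻¹) := by
      rw [mul_sub, mul_inv_cancel₀ hqn.ne']
      linarith
    refine hle.trans (mul_le_mul_of_nonneg_left ?_ hqn.le)
    have hinv : (q ^ N)⁻¹ ≤ (q ^ n)⁻¹ := by
      gcongr
      exact hq.le
    have hc : min (-Real.log √ρ) ((q ^ N)⁻¹ / (N + 1)) * n ≤ (q ^ N)⁻¹ := by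
      calc min (-Real.log √ρ) ((q ^ N)⁻¹ / (N + 1)) * n ≤ (q ^ N)⁻¹ / (N + 1) * (N + 1) := by
            have : (n : ℝ) ≤ N := by exact_mod_cast hNn
            gcongr
            · exact min_le_right _ _
            · linarith
        _ = (q ^ N)⁻¹ := by field_simp
    have := Real.add_one_le_exp (-min (-Real.log √ρ) ((q ^ N)⁻¹ / (N + 1)) * n)
    linarith

theorem mainTheorem3 (p : ℕ) [Fact p.Prime] (hp : p ≠ 5) :
    ∃ c : ℝ, 0 < c ∧ ∀ (n : ℕ) (A : Finset (Fin n → ZMod p)),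
      (¬ ∃ (x : Fin 5 → (Fin n → ZMod p)) (y : Fin n → ZMod p),
          (∀ i, x i ∈ A) ∧ y ∈ A ∧
            x 0 + x 1 + x 2 + x 3 + x 4 = (5 : ZMod p) • y ∧ ∃ i, x i ≠ y) →
      (A.card : ℝ) ≤
        (p : ℝ) ^ n * Real.exp (-c * (Real.logb 2 ((p : ℝ) ^ n)) ^ ((1 : ℝ) / 5)) := by
  have hp2 : 2 ≤ p := (Fact.out : p.Prime).two_le
  have hp2' : (2 : ℝ) ≤ p := by exact_mod_cast hp2
  obtain ⟨ρ, h0, h1, hρ⟩ := exists_card_le_of_threeAPFree p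
  obtain ⟨c, hc, hdecay⟩ := exists_exp_decay_of_le (q := p) (by linarith) h0 h1
  have hL : 1 ≤ Real.logb 2 p := by
    rw [Real.le_logb_iff_rpow_le one_lt_two (by linarith)]
    simpa using hp2'
  refine ⟨c / Real.logb 2 p, by positivity, fun n A hA => ?_⟩
  -- In dimension 0 the logarithm vanishes and 0^(1/5) = 0, so the bound is 1.
  rcases eq_or_ne n 0 with rfl | hn
  · have : A.card ≤ 1 := Finset.card_le_one_of_subsingleton A
    simpa using this
  have hfree : ∀ x ∈ A, ∀ y ∈ A, ∀ z ∈ A, x + y = (2 : ZMod p) • z → x = z ∧ y = z := by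
    intro x hx y hy z hz hxyz
    by_contra hne
    refine hA ⟨![x, y, z, z, z], z, fun i => by fin_cases i <;> simpa, hz, ?_, ?_⟩
    · simp only [Fin.isValue, Matrix.cons_val]
      rw [hxyz]
      module
    · by_contra! hall
      exact hne ⟨hall 0, hall 1⟩
  have hcard := card_lt_of_threeAPFree p hn A hfree
  refine (hdecay n A.card (hρ n A hfree) (by exact_mod_cast hcard)).trans ?_
  have hn1 : (1 : ℝ) ≤ n := by exact_mod_cast Nat.one_le_iff_ne_zero.2 hn
  refine mul_le_mul_of_nonneg_left (Real.exp_le_exp.2 ?_) (by positivity)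
  rw [Real.logb_pow, neg_mul, neg_mul, neg_le_neg_iff]
  -- The base is at least 1, so lowering the exponent from 1 to 1/5 only weakens the bound.
  have hrpow : (n * Real.logb 2 p) ^ ((1 : ℝ) / 5) ≤ n * Real.logb 2 p :=
    (Real.rpow_le_rpow_of_exponent_le (by nlinarith) (by norm_num)).trans (Real.rpow_one _).le
  calc c / Real.logb 2 p * (n * Real.logb 2 p) ^ ((1 : ℝ) / 5)
      ≤ c / Real.logb 2 p * (n * Real.logb 2 p) := by gcongr
    _ = c * n := by field_simp
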